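/- A covering integer program (CIP) in $n$ variables with constraints $j=1,\dots,m$ is $$\min\Big\{\sum_{i=1}^n c_i x_i \;:\; \sum_{i=1}^n a_{ij}x_i\ge 1\ (j=1,\dots,m),\quad 0\le x_i\le u_i,\ x_i\in\mathbb Z\ (i=1,\dots,n)\Big\},$$ where all $a_{ij},c_i,u_i$ are non-negative reals; $\mathrm{OPT}$ denotes its optimal value. Variable $i$ appears in constraint $j$ if $a_{ij}\neq 0$. The row sparsity $k$ is the maximum number of variables appearing in a constraint, and the column sparsity $\ell$ is the maximum number of constraints in which a variable appears; if one of these numbers is less than $2$, then $k$ (respectively $\ell$) stands for $2$. In the online setting the constraints arrive one after another. A randomized online algorithm knows $n$ and draws a random seed, whose law is independent of the input, before the first arrival. The integer vector $X^{(t)}$ that it holds after the first $t$ constraints is a function of the seed, of these $t$ constraints, and of the numbers $c_i,u_i$ for the variables $i$ that appear in them. (In particular it does not know $m$, $k$, $\ell$, the later constraints, or the costs and bounds of variables that have not appeared yet.) Theorem. There are an absolute constant $C>0$ and a randomized online algorithm such that, for every $n$ and every CIP in $n$ variables that has a feasible integral solution (fixed independently of the seed), the following holds. For every value of the seed, $0\le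 X^{(t)}_i\le u_i$ and $X^{(t)}\in\mathbb Z^n$ satisfies the first $t$ constraints, for all $0\le t\le m$, and $X^{(0)}\le X^{(1)}\le\dots\le X^{(m)}$ coordinatewise. Moreover $$\mathbb E\Big[\sum_{i=1}^n c_i X^{(m)}_i\Big]\;\le\; C\,\log k\,\log \ell\cdot \mathrm{OPT}.$$ -/

import Mathlib

open MeasureTheory

/-- A covering integer program on the variables `x_0, …, x_{n-1}`: minimise `∑ i, cost i * x i` over
integral `x` with `0 ≤ x i ≤ bound i` and `∑ i, r i * x i ≥ 1` for every row `r`.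
All data are non-negative reals. The rows are listed in their order of arrival. -/
structure CIP (n : ℕ) where
  rows : List (Fin n → ℝ)
  cost : Fin n → ℝ
  bound : Fin n → ℝ
  rows_nonneg : ∀ r ∈ rows, ∀ i, 0 ≤ r i
  cost_nonneg : ∀ i, 0 ≤ cost i
  bound_nonneg : ∀ i, 0 ≤ bound i

noncomputable section

namespace CIP

variable {n : ℕ}

/-- `x` is a feasible integral solution. -/
def IsSolution (P : CIP n) (x : Fin n → ℤ) : Prop :=
  (∀ i, 0 ≤ x i ∧ (x i : ℝ) ≤ P.bound i) ∧ ∀ r ∈ P.rows, 1 ≤ ∑ i, r i * (x i : ℝ)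

/-- The objective value of `x`. -/
def value (P : CIP n) (x : Fin n → ℤ) : ℝ := ∑ i, P.cost i * (x i : ℝ)

/-- The program has a feasible integral solution. -/
def Feasible (P : CIP n) : Prop := ∃ x, P.IsSolution x

/-- The optimal integral value (the infimum is a minimum as soon as the program is feasible). -/
def opt (P : CIP n) : ℝ := sInf (P.value '' {x | P.IsSolution x})

/-- Row sparsity: the maximum number of non-zero entries of a row. -/
def rowSparsity (P : CIP n) : ℕ :=
  (P.rows.map fun r => (Finset.univ.filter fun i => r i ≠ 0).card).foldr max 0

/-- Column sparsity: the maximum, over the variables, of the number of rows in which the variable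
appears (equal rows that arrive several times are counted separately). -/
def colSparsity (P : CIP n) : ℕ :=
  Finset.univ.sup fun i => P.rows.countP fun r => decide (r i ≠ 0)

/-- The program consisting of the first `t` constraints only. -/
def truncate (P : CIP n) (t : ℕ) : CIP n where
  rows := P.rows.take t
  cost := P.cost
  bound := P.bound
  rows_nonneg := fun r hr => P.rows_nonneg r (List.mem_of_mem_take hr)
  cost_nonneg := P.cost_nonneg
  bound_nonneg := P.bound_nonneg

/-- The variable `i` appears in some constraint. -/
def Appears (P : CIP n) (i : Fin n) : Prop := ∃ r ∈ P.rows, r i ≠ 0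

open Classical in
/-- What can be seen of the program: all its rows, but the cost and the upper bound of a variable
only if the variable appears in one of these rows (otherwise they are replaced by `0`). -/
def visible (P : CIP n) : CIP n where
  rows := P.rows
  cost := fun i => if P.Appears i then P.cost i else 0
  bound := fun i => if P.Appears i then P.bound i else 0
  rows_nonneg := P.rows_nonneg
  cost_nonneg := fun i => by
    split_ifs
    · exact P.cost_nonneg i
    · exact le_rfl
  bound_nonneg := fun i => by
    split_ifs
    · exact P.bound_nonneg i
    · exact le_rfl

end CIP

/-- A randomized online algorithm for covering integer programs in `n` variables. All its random
choices are contained in a seed `ω`, whose law `μ` does not depend on the input. The vector that it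
holds at some time is a function of the seed and of the part of the input visible at that time. -/
structure RandomizedOnlineAlgorithm (n : ℕ) where
  Ω : Type
  [measurableSpace : MeasurableSpace Ω]
  μ : Measure Ω
  [isProbabilityMeasure : IsProbabilityMeasure μ]
  output : CIP n → Ω → Fin n → ℤ
  measurable_output : ∀ H, Measurable (output H)

namespace RandomizedOnlineAlgorithm

attribute [instance] measurableSpace isProbabilityMeasure

variable {n : ℕ}

/-- The vector held immediately after the first `t` constraints of `P` have been processed: it may
depend only on these `t` constraints and on the costs and bounds of the variables in them. -/
def solution (alg : RandomizedOnlineAlgorithm n) (P : CIP n) (t : ℕ) (ω : alg.Ω) : Fin n → ℤ :=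
  alg.output (P.truncate t).visible ω

/-- On every feasible program, fixed independently of the seed, and for every seed, the algorithm
holds after each arrival a feasible integral solution of the constraints that have arrived so far,
and never decreases a coordinate; and the expected cost of its final solution is at most
`ratio P` times the optimum. -/
def IsCompetitive (alg : RandomizedOnlineAlgorithm n) (ratio : CIP n → ℝ) : Prop :=
  ∀ P : CIP n, P.Feasible →
    (∀ ω, ∀ t ≤ P.rows.length, (P.truncate t).IsSolution (alg.solution P t ω)) ∧
    (∀ ω, ∀ s t, s ≤ t → t ≤ P.rows.length →
      ∀ i, alg.solution P s ω i ≤ alg.solution P t ω i) ∧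
    Integrable (fun ω => P.value (alg.solution P P.rows.length ω)) alg.μ ∧
    ∫ ω, P.value (alg.solution P P.rows.length ω) ∂alg.μ ≤ ratio P * P.opt

end RandomizedOnlineAlgorithm

end

/-! A fractional vector `x` only increases, and a multiple `α * x` of it, with `α` of order log ℓ,
is rounded. On arrival of a row, `x` needs to satisfy only the knapsack cover inequality of its own
saturated set: with the variables `α * x i ≥ v i` fixed at their bounds `v i`, the others must meet
the residual demand b up to a factor two, with coefficients a_i = min (r i) b. While this fails,
moving x_i at rate (a_i x_i + b/K)/c_i, where K is the number of variables in the row (and c_i > 0),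
costs at most 3b/2 per unit of time. Meanwhile the potential ∑ c_i X_i log((x_i + X_i/k)/(x_i +
X_i)) gains at least b/8, for every integral solution X of the row and every k ≥ max(2, K)
(`coverPotential_step`). Neither X nor k enters the rule. The potential starts at -log k · c(X) and
stays nonpositive, so x costs at most 12 log k · OPT.

Each variable has one uniform threshold for all times, so the rounding is monotone. With α = 4 + 8
log ℓ_t, where ℓ_t is the column sparsity seen so far, an exponential moment bound makes a row fail
with probability at most ℓ_t⁻² (`integral_roundFails_le`). A failing row is completed by a cheapest
solution of that row alone, costing at most ∑ c_i X_i over its variables. At the s-th appearance of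
i one has ℓ_t ≥ s, so the expected charge to c_i X_i is at most ∑ s⁻² ≤ 2 times it
(`sum_inv_sq_le_two`). -/

noncomputable section

/-! ### The logarithmic potential -/

/-- The potential of a variable with fractional value `x` against the optimal value `X`. -/
def coverPotential (k : ℕ) (X x : ℝ) : ℝ := X * Real.log ((x + X / k) / (x + X))

theorem coverPotential_nonpos {k : ℕ} (hk : 1 ≤ k) {X x : ℝ} (hX : 0 ≤ X) (hx : 0 ≤ x) :
    coverPotential k X x ≤ 0 := by
  have hk' : (1 : ℝ) ≤ k := by exact_mod_cast hk
  have h1 : X / k ≤ X := div_le_self hX hk'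
  have h2 : 0 ≤ X / k := by positivity
  exact mul_nonpos_of_nonneg_of_nonpos hX
    (Real.log_nonpos (by positivity) (div_le_one_of_le₀ (by linarith) (by positivity)))

theorem coverPotential_zero (k : ℕ) (X : ℝ) :
    coverPotential k X 0 = -(X * Real.log k) := by
  unfold coverPotential
  by_cases hX : X = 0
  · simp [hX]
  · rw [zero_add, zero_add, div_right_comm, div_self hX, one_div, Real.log_inv]
    ring

theorem continuousOn_coverPotential {k : ℕ} (hk : 1 ≤ k) {X : ℝ} (hX : 0 ≤ X) :
    ContinuousOn (coverPotential k X) (Set.Ici 0) := by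
  have hk' : (0 : ℝ) < k := by exact_mod_cast hk
  rcases hX.eq_or_lt with rfl | hX
  · have : coverPotential k 0 = fun _ => 0 := by ext; simp [coverPotential]
    rw [this]
    exact continuousOn_const
  · have h (x : ℝ) (hx : x ∈ Set.Ici (0 : ℝ)) : x + X ≠ 0 ∧ (x + X / k) / (x + X) ≠ 0 := by
      have : (0 : ℝ) ≤ x := hx
      constructor <;> positivity
    exact continuousOn_const.mul
      (ContinuousOn.log ((by fun_prop : Continuous fun x : ℝ => x + X / k).continuousOn.div
        (by fun_prop : Continuous fun x : ℝ => x + X).continuousOn fun x hx => (h x hx).1)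
        fun x hx => (h x hx).2)

/-- The derivative of the potential in `x` is X(X - δ)/((x + δ)(x + X)) with δ = X/k. For a step of
length d, the x + δ in the denominator becomes x + d + δ; the condition `ε * a ≤ c` keeps d small
enough for this to lose only a factor two. Another factor two comes from X - δ ≥ X/2, as k ≥ 2. -/
theorem coverPotential_step {a b c x X ε : ℝ} {K k : ℕ} (ha : 0 ≤ a) (hb : 0 < b) (hc : 0 < c)
    (hx : 0 ≤ x) (hX : 0 ≤ X) (hε : 0 < ε) (hK : 1 ≤ K) (hKk : K ≤ k) (hk : 2 ≤ k)
    (hεa : ε * a ≤ c) :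
    ε / 4 * (min (a * X) b - a * x) ≤
      c * (coverPotential k X (x + ε * (a * x + b / K) / c) - coverPotential k X x) := by
  rcases hX.eq_or_lt with rfl | hX
  · simp only [coverPotential, mul_zero, zero_mul, sub_zero]
    rw [min_eq_left hb.le]
    have := mul_nonneg hε.le (mul_nonneg ha hx)
    linarith
  have hK' : (0 : ℝ) < K := by exact_mod_cast hK
  have hk' : (2 : ℝ) ≤ k := by exact_mod_cast hk
  have hKk' : (K : ℝ) ≤ k := by exact_mod_cast hKk
  have hk0 : (0 : ℝ) < k := by linarith
  set d := ε * (a * x + b / K) / c with hd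
  set δ := X / k with hδ
  set m := min (a * X) b with hm
  have hd0 : 0 ≤ d := by positivity
  have hδ0 : 0 < δ := by positivity
  have hcd : c * d = ε * (a * x + b / K) := by rw [hd]; field_simp
  have hδX : 2 * δ ≤ X := by
    rw [hδ, ← mul_div_assoc, div_le_iff₀ hk0]
    nlinarith
  have hm0 : 0 ≤ m := le_min (by positivity) hb.le
  have hmaX : m ≤ a * X := min_le_left _ _
  have hmb : m ≤ b := min_le_right _ _
  -- the logarithm grows at least by `z / (1 + z)`
  have hlog : d * (X - δ) / ((x + d + δ) * (x + X)) ≤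
      Real.log ((x + d + δ) / (x + d + X)) - Real.log ((x + δ) / (x + X)) := by
    rw [← Real.log_div (by positivity) (by positivity)]
    have h1 := Real.one_sub_inv_le_log_of_pos
      (x := (x + d + δ) / (x + d + X) / ((x + δ) / (x + X))) (by positivity)
    refine le_trans (le_of_eq ?_) h1
    field_simp
    ring
  have hδb : m * δ ≤ b / K * X := by
    have : b / k ≤ b / K := div_le_div_of_nonneg_left hb.le hK' hKk'
    calc m * δ ≤ b * δ := by gcongr
      _ = b / k * X := by rw [hδ]; ring
      _ ≤ b / K * X := by gcongr
  have hdm : m * d ≤ (a * x + b / K) * X := by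
    have h2 : c * (m * d) ≤ c * ((a * x + b / K) * X) := by
      have : c * (m * d) = m * ε * (a * x + b / K) := by rw [mul_left_comm, hcd]; ring
      rw [this]
      have h3 : m * ε ≤ c * X := by nlinarith
      calc m * ε * (a * x + b / K) ≤ c * X * (a * x + b / K) := by gcongr
        _ = _ := by ring
    exact le_of_mul_le_mul_left h2 hc
  -- The terms m x and m δ together are at most (a x + b/K) X, because m ≤ a X, m ≤ b and K ≤ k; the
  -- term m d is bounded by the same quantity.
  have key : m * (x + d + δ) ≤ 2 * ((a * x + b / K) * X) := by
    have : m * x ≤ a * x * X := by nlinarith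
    nlinarith
  have hX0 : m - a * x ≤ m * X / (x + X) := by
    rw [le_div_iff₀ (by positivity)]
    nlinarith [mul_nonneg ha (mul_nonneg hx hx)]
  have h4 : ε / 4 * (m * X / (x + X)) ≤
      c * (X * (d * (X - δ) / ((x + d + δ) * (x + X)))) := by
    have e : c * (X * (d * (X - δ) / ((x + d + δ) * (x + X)))) =
        (c * d) * ((X - δ) / (x + d + δ)) * (X / (x + X)) := by field_simp
    rw [e, hcd, mul_div_assoc m, ← mul_assoc]
    refine mul_le_mul_of_nonneg_right ?_ (by positivity)
    rw [← mul_div_assoc, le_div_iff₀ (by positivity)]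
    calc ε / 4 * m * (x + d + δ) = ε / 4 * (m * (x + d + δ)) := by ring
      _ ≤ ε / 4 * (2 * ((a * x + b / K) * X)) := by gcongr
      _ = ε * (a * x + b / K) * (X / 2) := by ring
      _ ≤ ε * (a * x + b / K) * (X - δ) := by gcongr; linarith
  calc ε / 4 * (m - a * x) ≤ ε / 4 * (m * X / (x + X)) := by gcongr
    _ ≤ _ := h4
    _ ≤ c * (X * (Real.log ((x + d + δ) / (x + d + X)) - Real.log ((x + δ) / (x + X)))) := by
      gcongr
    _ = _ := by simp only [coverPotential]; ring

/-- Truncated coefficients still cover the demand `b`, even with every term cut off at `b`. -/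
theorem le_sum_min_of_le_sum {ι : Type*} (T : Finset ι) (r : ι → ℝ) (X : ι → ℤ) {b : ℝ}
    (hb : 0 < b) (hr : ∀ i, 0 ≤ r i) (hX : ∀ i, 0 ≤ X i) (h : b ≤ ∑ i ∈ T, r i * X i) :
    b ≤ ∑ i ∈ T, min (min (r i) b * X i) b := by
  have hX' (i) : (0 : ℝ) ≤ X i := by exact_mod_cast hX i
  have hX1 (i) (hi : X i ≠ 0) : (1 : ℝ) ≤ X i := by
    have := hX i
    exact_mod_cast (by omega : (1 : ℤ) ≤ X i)
  by_cases hex : ∃ i ∈ T, b ≤ r i * X i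
  -- Integrality enters here: X i ≥ 1, so one large term still covers `b` after both truncations. If
  -- there is no such term, truncation changes nothing.
  · obtain ⟨i, hiT, hi⟩ := hex
    have h0 : X i ≠ 0 := by
      intro h0
      rw [h0] at hi
      simp at hi
      linarith
    have : b ≤ min (min (r i) b * X i) b := by
      refine le_min ?_ le_rfl
      rw [min_mul_of_nonneg _ _ (hX' i)]
      exact le_min hi (by nlinarith [hX1 i h0])
    refine this.trans (Finset.single_le_sum (f := fun i => min (min (r i) b * X i) b) ?_ hiT)
    exact fun j _ => le_min (mul_nonneg (le_min (hr j) hb.le) (hX' j)) hb.le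
  · push Not at hex
    refine h.trans (Finset.sum_le_sum fun i hi => ?_)
    by_cases h0 : X i = 0
    · simp [h0, hb.le]
    · have h1 := hX1 i h0
      have h2 := hex i hi
      have h3 : r i ≤ b := by nlinarith [hr i]
      rw [min_eq_left h3, min_eq_left h2.le]

variable {n : ℕ}

/-! ### The fractional update and knapsack cover inequalities -/

/-- The variables whose scaled fractional value reaches the integral upper bound `v`. -/
def saturated (v : Fin n → ℤ) (α : ℝ) (x : Fin n → ℝ) : Finset (Fin n) :=
  Finset.univ.filter fun i => (v i : ℝ) ≤ α * x i

/-- What the row `r` still demands when the saturated variables are at their upper bounds. -/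
def residualDemand (r : Fin n → ℝ) (v : Fin n → ℤ) (α : ℝ) (x : Fin n → ℝ) : ℝ :=
  1 - ∑ i ∈ saturated v α x, r i * v i

/-- `x` satisfies, up to a factor two, the knapsack cover inequality of its saturated variables. -/
def HalfCovers (r : Fin n → ℝ) (v : Fin n → ℤ) (α : ℝ) (x : Fin n → ℝ) : Prop :=
  0 < residualDemand r v α x →
    residualDemand r v α x ≤ 2 * ∑ i ∈ (saturated v α x)ᶜ, min (r i) (residualDemand r v α x) * x i

/-- `X` is an integral solution of the row `r`, subject to the bounds on the variables in it. -/
def RowSolution (r : Fin n → ℝ) (v X : Fin n → ℤ) : Prop :=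
  (∀ i, 0 ≤ X i) ∧ (∀ i, r i ≠ 0 → X i ≤ v i) ∧ 1 ≤ ∑ i, r i * (X i : ℝ)

/-- The variables that appear in the row `r`. -/
def rowSupport (r : Fin n → ℝ) : Finset (Fin n) := Finset.univ.filter fun i => r i ≠ 0

/-- The increase in cost from `x` to `y` is paid for by the increase in potential, against every
integral solution of the row. -/
def PaidFor (r c : Fin n → ℝ) (v : Fin n → ℤ) (x y : Fin n → ℝ) : Prop :=
  ∀ X, RowSolution r v X → ∀ k : ℕ, 2 ≤ k → (rowSupport r).card ≤ k →
    ∑ i, c i * (y i - x i) ≤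
      12 * ∑ i, c i * (coverPotential k (X i) (y i) - coverPotential k (X i) (x i))

theorem PaidFor.trans {r c : Fin n → ℝ} {v : Fin n → ℤ} {x y z : Fin n → ℝ}
    (h₁ : PaidFor r c v x y) (h₂ : PaidFor r c v y z) : PaidFor r c v x z := by
  intro X hX k hk hrk
  have h1 := h₁ X hX k hk hrk
  have h2 := h₂ X hX k hk hrk
  have e1 : ∑ i, c i * (z i - x i) = ∑ i, c i * (y i - x i) + ∑ i, c i * (z i - y i) := by
    rw [← Finset.sum_add_distrib]
    exact Finset.sum_congr rfl fun i _ => by ring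
  have e2 : ∑ i, c i * (coverPotential k (X i) (z i) - coverPotential k (X i) (x i)) =
      ∑ i, c i * (coverPotential k (X i) (y i) - coverPotential k (X i) (x i)) +
      ∑ i, c i * (coverPotential k (X i) (z i) - coverPotential k (X i) (y i)) := by
    rw [← Finset.sum_add_distrib]
    exact Finset.sum_congr rfl fun i _ => by ring
  rw [e1, e2]
  linarith

/-- The specification of the fractional update from `x` to `y` on arrival of the row `r`. -/
structure IsFracUpdate (r c : Fin n → ℝ) (v : Fin n → ℤ) (α : ℝ) (x y : Fin n → ℝ) : Prop where
  le : ∀ i, x i ≤ y i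
  eq_of_eq_zero : ∀ i, r i = 0 → y i = x i
  halfCovers : HalfCovers r v α y
  paidFor : PaidFor r c v x y

theorem isClosed_paidFor_inter_Icc (r c : Fin n → ℝ) (v : Fin n → ℤ) {x : Fin n → ℝ}
    (hx : ∀ i, 0 ≤ x i) (hi : Fin n → ℝ) :
    IsClosed (Set.Icc x hi ∩ {y | PaidFor r c v x y}) := by
  have e : Set.Icc x hi ∩ {y | PaidFor r c v x y} = Set.Icc x hi ∩
      ⋂ (X) (_ : RowSolution r v X) (k : ℕ) (_ : 2 ≤ k) (_ : (rowSupport r).card ≤ k),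
        (Set.Icc x hi ∩ {y | ∑ i, c i * (y i - x i) ≤
          12 * ∑ i, c i * (coverPotential k (X i) (y i) - coverPotential k (X i) (x i))}) := by
    ext y
    simp only [PaidFor, Set.mem_inter_iff, Set.mem_iInter, Set.mem_ofPred_eq]
    exact ⟨fun h => ⟨h.1, fun X hX k hk hrk => ⟨h.1, h.2 X hX k hk hrk⟩⟩,
      fun h => ⟨h.1, fun X hX k hk hrk => (h.2 X hX k hk hrk).2⟩⟩
  rw [e]
  refine isClosed_Icc.inter (isClosed_iInter fun X => isClosed_iInter fun hX =>
    isClosed_iInter fun k => isClosed_iInter fun hk => isClosed_iInter fun _ => ?_)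
  -- The potential is continuous only on nonnegative arguments, hence the intersection with the box
  -- above `x`.
  refine IsClosed.isClosed_le isClosed_Icc
    (by fun_prop : Continuous fun y : Fin n → ℝ => ∑ i, c i * (y i - x i)).continuousOn ?_
  refine continuousOn_const.mul (continuousOn_finsetSum _ fun i _ => continuousOn_const.mul
    (ContinuousOn.sub ?_ continuousOn_const))
  refine (continuousOn_coverPotential (by omega) (by exact_mod_cast hX.1 i)).comp
    (continuous_apply i).continuousOn fun y hy => ?_
  exact (hx i).trans (hy.1 i)

/-- On the saturated set `X` contributes at most as much as the upper bounds do, so the rest of the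
row has to supply the residual demand. -/
theorem residualDemand_le_sum {r : Fin n → ℝ} {v X : Fin n → ℤ} (hr : ∀ i, 0 ≤ r i)
    (hX : RowSolution r v X) (α : ℝ) (y : Fin n → ℝ) :
    residualDemand r v α y ≤ ∑ i ∈ (saturated v α y)ᶜ ∩ rowSupport r, r i * X i := by
  have h1 : ∑ i ∈ saturated v α y, r i * (X i : ℝ) ≤ ∑ i ∈ saturated v α y, r i * (v i : ℝ) := by
    refine Finset.sum_le_sum fun i _ => ?_
    by_cases h : r i = 0
    · simp [h]
    · exact mul_le_mul_of_nonneg_left (by exact_mod_cast hX.2.1 i h) (hr i)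
  have h2 : ∑ i ∈ (saturated v α y)ᶜ ∩ rowSupport r, r i * (X i : ℝ) =
      ∑ i ∈ (saturated v α y)ᶜ, r i * (X i : ℝ) := by
    refine Finset.sum_subset Finset.inter_subset_left fun i hi hi' => ?_
    have : r i = 0 := by
      by_contra h
      exact hi' (Finset.mem_inter.2 ⟨hi, by simp [rowSupport, h]⟩)
    simp [this]
  have h3 := Finset.sum_add_sum_compl (saturated v α y) fun i => r i * (X i : ℝ)
  have h4 := hX.2.2
  rw [h2]
  unfold residualDemand
  linarith

/-- A point that violates its knapsack cover inequality can be increased further. -/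
theorem exists_paidFor_lt {r c : Fin n → ℝ} {v X₀ : Fin n → ℤ} {α : ℝ} {y : Fin n → ℝ}
    (hr : ∀ i, 0 ≤ r i) (hc : ∀ i, 0 ≤ c i) (hα : 0 < α) (hy : ∀ i, 0 ≤ y i)
    (hX₀ : RowSolution r v X₀) (hcov : ¬ HalfCovers r v α y) :
    ∃ z, PaidFor r c v y z ∧ (∀ i, y i ≤ z i) ∧ (∃ i, y i < z i) ∧
      (∀ i, z i ≠ y i → r i ≠ 0 ∧ z i ≤ v i / α) := by
  unfold HalfCovers at hcov
  push Not at hcov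
  obtain ⟨hb, hlt⟩ := hcov
  have hres := fun X (hX : RowSolution r v X) => residualDemand_le_sum hr hX α y
  set b := residualDemand r v α y with hbdef
  set T := (saturated v α y)ᶜ ∩ rowSupport r with hT
  have hTmem (i) (hi : i ∈ T) : y i < v i / α ∧ r i ≠ 0 := by
    simp only [hT, saturated, rowSupport, Finset.mem_inter, Finset.mem_compl, Finset.mem_filter,
      Finset.mem_univ, true_and, not_le] at hi
    exact ⟨by rw [lt_div_iff₀ hα]; linarith [hi.1], hi.2⟩
  have hTne : T.Nonempty := by
    by_contra h
    have := hres X₀ hX₀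
    rw [Finset.not_nonempty_iff_eq_empty.1 h] at this
    simp at this
    linarith
  by_cases hzero : ∃ i ∈ T, c i = 0
  · obtain ⟨i, hiT, hci⟩ := hzero
    -- A free variable can jump to its cap: with cost zero, neither side of `PaidFor` changes.
    refine ⟨Function.update y i (v i / α), fun X _ k _ _ => ?_, fun j => ?_,
      ⟨i, by simpa using (hTmem i hiT).1⟩, fun j hj => ?_⟩
    · rw [Finset.sum_eq_zero, Finset.sum_eq_zero, mul_zero]
      all_goals
        intro j _
        by_cases hj : j = i
        · subst hj; simp [hci]
        · simp [hj]
    · by_cases hj : j = i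
      · subst hj; simpa using (hTmem j hiT).1.le
      · simp [hj]
    · by_cases hj' : j = i
      · subst hj'; exact ⟨(hTmem j hiT).2, by simp⟩
      · simp [hj'] at hj
  push Not at hzero
  have hcpos (i) (hi : i ∈ T) : 0 < c i := lt_of_le_of_ne (hc i) (hzero i hi).symm
  set K := (rowSupport r).card with hK
  have hTK : T.card ≤ K := Finset.card_le_card Finset.inter_subset_right
  have hK1 : 1 ≤ K := hTne.card_pos.trans_le hTK
  have hK0 : (0 : ℝ) < K := by exact_mod_cast hK1
  set a : Fin n → ℝ := fun i => min (r i) b with ha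
  have ha0 (i) : 0 ≤ a i := le_min (hr i) hb.le
  -- Both conditions hold strictly at ε = 0, hence for all small positive ε.
  obtain ⟨ε, hε, hεT⟩ : ∃ ε : ℝ, 0 < ε ∧ ∀ i ∈ T, ε * a i ≤ c i ∧
      y i + ε * (a i * y i + b / K) / c i ≤ v i / α := by
    have h : ∀ᶠ ε in nhdsWithin (0 : ℝ) (Set.Ioi 0), ∀ i ∈ T, ε * a i ≤ c i ∧
        y i + ε * (a i * y i + b / K) / c i ≤ v i / α := by
      refine (Filter.eventually_all_finset T).2 fun i hi => Filter.Eventually.filter_mono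
        nhdsWithin_le_nhds (Filter.Eventually.and ?_ ?_)
      · have : Continuous fun ε : ℝ => ε * a i := by fun_prop
        exact (this.tendsto 0).eventually_le_const (by simpa using hcpos i hi)
      · have : Continuous fun ε : ℝ => y i + ε * (a i * y i + b / K) / c i := by fun_prop
        exact (this.tendsto 0).eventually_le_const (by simpa using (hTmem i hi).1)
    obtain ⟨ε, h1, h2⟩ := (h.and self_mem_nhdsWithin).exists
    exact ⟨ε, h2, h1⟩
  have hinc (i) (hi : i ∈ T) : 0 < ε * (a i * y i + b / K) / c i := by
    have := hcpos i hi
    have := mul_nonneg (ha0 i) (hy i)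
    positivity
  refine ⟨fun i => if i ∈ T then y i + ε * (a i * y i + b / K) / c i else y i,
    fun X hX k hk hrk => ?_, fun i => ?_, ?_, fun i hi => ?_⟩
  · have hsum (f : Fin n → ℝ → ℝ) (hf : ∀ i, f i (y i) = 0) :
        ∑ i, f i (if i ∈ T then y i + ε * (a i * y i + b / K) / c i else y i) =
        ∑ i ∈ T, f i (y i + ε * (a i * y i + b / K) / c i) := by
      rw [← Finset.sum_subset (Finset.subset_univ T)]
      · exact Finset.sum_congr rfl fun i hi => by rw [if_pos hi]
      · intro i _ hi
        rw [if_neg hi, hf]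
    rw [hsum (fun i t => c i * (t - y i)) (by simp),
      hsum (fun i t => c i * (coverPotential k (X i) t - coverPotential k (X i) (y i))) (by simp)]
    have hay : ∑ i ∈ T, a i * y i ≤ b / 2 := by
      have : ∑ i ∈ T, a i * y i ≤ ∑ i ∈ (saturated v α y)ᶜ, a i * y i :=
        Finset.sum_le_sum_of_subset_of_nonneg Finset.inter_subset_left
          fun i _ _ => mul_nonneg (ha0 i) (hy i)
      linarith
    -- The violated inequality gives ∑ a y ≤ b/2, and the terms b/K add at most b. The gain below is
    -- ε/4 · (b - b/2); the quotient of 3b/2 and b/8 is the constant 12 in `PaidFor`.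
    have hcost : ∑ i ∈ T, c i * (y i + ε * (a i * y i + b / K) / c i - y i) ≤
        ε * (3 / 2 * b) := by
      calc _ = ∑ i ∈ T, ε * (a i * y i + b / K) := Finset.sum_congr rfl fun i hi => by
            have := (hcpos i hi).ne'
            field_simp
            ring
        _ = ε * (∑ i ∈ T, a i * y i + T.card * (b / K)) := by
            rw [← Finset.mul_sum, Finset.sum_add_distrib, Finset.sum_const, nsmul_eq_mul]
        _ ≤ ε * (b / 2 + K * (b / K)) := by
            have : (T.card : ℝ) ≤ K := by exact_mod_cast hTK
            gcongr
        _ = ε * (3 / 2 * b) := by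
            field_simp
            ring
    have hpot : ε * (b / 8) ≤ ∑ i ∈ T, c i * (coverPotential k (X i)
        (y i + ε * (a i * y i + b / K) / c i) - coverPotential k (X i) (y i)) := by
      have hm := le_sum_min_of_le_sum T r X hb hr hX.1 (hres X hX)
      calc ε * (b / 8) ≤ ε / 4 * (∑ i ∈ T, min (a i * X i) b - ∑ i ∈ T, a i * y i) := by
            have : b / 2 ≤ ∑ i ∈ T, min (a i * X i) b - ∑ i ∈ T, a i * y i := by linarith
            nlinarith
        _ = ∑ i ∈ T, ε / 4 * (min (a i * X i) b - a i * y i) := by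
            rw [← Finset.sum_sub_distrib, Finset.mul_sum]
        _ ≤ _ := Finset.sum_le_sum fun i hi =>
            coverPotential_step (ha0 i) hb (hcpos i hi) (hy i) (by exact_mod_cast hX.1 i) hε hK1
              hrk hk (hεT i hi).1
    linarith
  · dsimp only
    split_ifs with hi
    · linarith [hinc i hi]
    · exact le_rfl
  · obtain ⟨i, hi⟩ := hTne
    exact ⟨i, by simp only [if_pos hi]; linarith [hinc i hi]⟩
  · dsimp only at hi ⊢
    split_ifs at hi ⊢ with hiT
    · exact ⟨(hTmem i hiT).2, (hεT i hiT).2⟩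
    · exact absurd rfl hi

/-- Compactness replaces a continuous-time process: among the paid-for points of a box, take one
with the largest coordinate sum. If it violated its knapsack cover inequality, it could be increased
further inside the box. -/
theorem exists_isFracUpdate {r c : Fin n → ℝ} {v X₀ : Fin n → ℤ} {α : ℝ} {x : Fin n → ℝ}
    (hr : ∀ i, 0 ≤ r i) (hc : ∀ i, 0 ≤ c i) (hα : 0 < α) (hx : ∀ i, 0 ≤ x i)
    (hX₀ : RowSolution r v X₀) : ∃ y, IsFracUpdate r c v α x y := by
  set hi : Fin n → ℝ := fun i => if r i = 0 then x i else max (x i) (v i / α) with hhi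
  have hxhi : x ≤ hi := fun i => by
    simp only [hhi]
    split_ifs
    · exact le_rfl
    · exact le_max_left _ _
  have hcomp : IsCompact (Set.Icc x hi ∩ {y | PaidFor r c v x y}) :=
    isCompact_Icc.of_isClosed_subset (isClosed_paidFor_inter_Icc r c v hx hi)
      Set.inter_subset_left
  obtain ⟨y, ⟨hyI, hyP⟩, hmax⟩ := hcomp.exists_isMaxOn (f := fun y : Fin n → ℝ => ∑ i, y i)
    ⟨x, ⟨le_rfl, hxhi⟩, fun X _ k _ _ => by simp⟩
    (by fun_prop : Continuous fun y : Fin n → ℝ => ∑ i, y i).continuousOn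
  refine ⟨y, hyI.1, fun i hri => ?_, ?_, hyP⟩
  · have := hyI.2 i
    simp only [hhi, if_pos hri] at this
    exact le_antisymm this (hyI.1 i)
  · by_contra hcov
    obtain ⟨z, hz1, hz2, ⟨j, hj⟩, hz4⟩ :=
      exists_paidFor_lt hr hc hα (fun i => (hx i).trans (hyI.1 i)) hX₀ hcov
    have hzS : z ∈ Set.Icc x hi ∩ {y | PaidFor r c v x y} := by
      refine ⟨⟨fun i => (hyI.1 i).trans (hz2 i), fun i => ?_⟩, hyP.trans hz1⟩
      by_cases h : z i = y i
      · rw [h]; exact hyI.2 i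
      · obtain ⟨h1, h2⟩ := hz4 i h
        simp only [hhi, if_neg h1]
        exact h2.trans (le_max_right _ _)
    have h1 : ∑ i, z i ≤ ∑ i, y i := hmax hzS
    have h2 : ∑ i, y i < ∑ i, z i :=
      Finset.sum_lt_sum (fun i _ => hz2 i) ⟨j, Finset.mem_univ j, hj⟩
    linarith

end

noncomputable section

/-! ### Randomized threshold rounding -/

/-- The uniform distribution on `[0, 1]`. -/
def uniformUnit : Measure ℝ := volume.restrict (Set.Icc 0 1)

instance : IsProbabilityMeasure uniformUnit := ⟨by simp [uniformUnit]⟩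

/-- Randomized rounding of `y` with threshold `θ`. -/
def thresholdRound (y θ : ℝ) : ℤ := ⌊y⌋ + if θ < Int.fract y then 1 else 0

theorem floor_le_thresholdRound (y θ : ℝ) : ⌊y⌋ ≤ thresholdRound y θ := by
  unfold thresholdRound
  split_ifs <;> omega

theorem thresholdRound_le_floor_add_one (y θ : ℝ) : thresholdRound y θ ≤ ⌊y⌋ + 1 := by
  unfold thresholdRound
  split_ifs <;> omega

theorem thresholdRound_nonneg {y : ℝ} (hy : 0 ≤ y) (θ : ℝ) : 0 ≤ thresholdRound y θ :=
  (Int.floor_nonneg.2 hy).trans (floor_le_thresholdRound y θ)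

theorem thresholdRound_mono {y y' : ℝ} (h : y ≤ y') (θ : ℝ) :
    thresholdRound y θ ≤ thresholdRound y' θ := by
  rcases (Int.floor_le_floor h).eq_or_lt with h1 | h1
  · have h2 : Int.fract y ≤ Int.fract y' := by
      rw [← Int.self_sub_floor, ← Int.self_sub_floor, h1]
      linarith
    unfold thresholdRound
    rw [h1]
    split_ifs with h3 h4 <;> first | omega | linarith
  · have := thresholdRound_le_floor_add_one y θ
    have := floor_le_thresholdRound y' θ
    omega

theorem measurable_thresholdRound (y : ℝ) : Measurable (thresholdRound y) :=
  measurable_const.add (Measurable.ite measurableSet_Iio measurable_const measurable_const)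

theorem integral_threshold {p : ℝ} (h0 : 0 ≤ p) (h1 : p ≤ 1) :
    Integrable (fun θ : ℝ => if θ < p then (1 : ℝ) else 0) uniformUnit ∧
    ∫ θ, (if θ < p then (1 : ℝ) else 0) ∂uniformUnit = p := by
  have e : (fun θ : ℝ => if θ < p then (1 : ℝ) else 0) = (Set.Iio p).indicator fun _ => 1 := by
    ext θ
    simp [Set.indicator]
  rw [e]
  refine ⟨(integrable_const _).indicator measurableSet_Iio, ?_⟩
  rw [integral_indicator_const _ measurableSet_Iio, uniformUnit,
    measureReal_restrict_apply measurableSet_Iio]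
  have : Set.Iio p ∩ Set.Icc 0 1 = Set.Ico 0 p := by
    ext t
    simp only [Set.mem_inter_iff, Set.mem_Iio, Set.mem_Icc, Set.mem_Ico]
    constructor
    · rintro ⟨h, h', _⟩; exact ⟨h', h⟩
    · rintro ⟨h, h'⟩; exact ⟨h', h, by linarith⟩
  rw [this]
  simp [h0]

theorem integral_thresholdRound (y : ℝ) :
    Integrable (fun θ => (thresholdRound y θ : ℝ)) uniformUnit ∧
    ∫ θ, (thresholdRound y θ : ℝ) ∂uniformUnit = y := by
  have e : (fun θ => (thresholdRound y θ : ℝ)) =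
      fun θ => (⌊y⌋ : ℝ) + if θ < Int.fract y then (1 : ℝ) else 0 := by
    ext θ
    unfold thresholdRound
    split_ifs <;> simp
  obtain ⟨h1, h2⟩ := integral_threshold (Int.fract_nonneg y) (Int.fract_lt_one y).le
  rw [e]
  refine ⟨(integrable_const _).add h1, ?_⟩
  rw [integral_add (integrable_const _) h1, h2]
  simp

/-- The integer part is deterministic, and the fractional part p contributes 1 - (1 - e⁻ʷ)p ≤ 1 -
wp/2 ≤ exp(-wp/2), since e⁻ʷ ≤ 1 - w/2 on [0, 1]. -/
theorem integral_exp_neg_thresholdRound_le {w y : ℝ} (hw0 : 0 ≤ w) (hw1 : w ≤ 1) (hy : 0 ≤ y) :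
    ∫ θ, Real.exp (-(w * thresholdRound y θ)) ∂uniformUnit ≤ Real.exp (-(w * y) / 2) := by
  have e : (fun θ => Real.exp (-(w * thresholdRound y θ))) = fun θ => Real.exp (-(w * ⌊y⌋)) *
      (1 - (1 - Real.exp (-w)) * if θ < Int.fract y then (1 : ℝ) else 0) := by
    ext θ
    unfold thresholdRound
    split_ifs
    · push_cast
      rw [mul_one, sub_sub_cancel, ← Real.exp_add]
      ring_nf
    · simp
  obtain ⟨h1, h2⟩ := integral_threshold (Int.fract_nonneg y) (Int.fract_lt_one y).le
  rw [e, integral_const_mul, integral_sub (integrable_const _) (h1.const_mul _),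
    integral_const_mul, h2, integral_const]
  simp only [probReal_univ, smul_eq_mul, mul_one]
  have hf : (0 : ℝ) ≤ ⌊y⌋ := by exact_mod_cast Int.floor_nonneg.2 hy
  have hp := Int.fract_nonneg y
  have hexp : Real.exp (-w) ≤ 1 - w / 2 := by
    rw [Real.exp_neg, inv_le_comm₀ (Real.exp_pos _) (by linarith)]
    refine le_trans ?_ (Real.add_one_le_exp w)
    rw [inv_le_iff_one_le_mul₀ (by linarith)]
    nlinarith
  have h3 : 1 - (1 - Real.exp (-w)) * Int.fract y ≤ Real.exp (-(w * Int.fract y) / 2) := by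
    have := Real.add_one_le_exp (-(w * Int.fract y) / 2)
    nlinarith
  have hy' : y = ⌊y⌋ + Int.fract y := (Int.floor_add_fract y).symm
  calc Real.exp (-(w * ⌊y⌋)) * (1 - (1 - Real.exp (-w)) * Int.fract y)
      ≤ Real.exp (-(w * ⌊y⌋) / 2) * Real.exp (-(w * Int.fract y) / 2) := by
        refine mul_le_mul (Real.exp_le_exp.2 ?_) h3 ?_ (Real.exp_pos _).le
        · have := mul_nonneg hw0 hf
          linarith
        · have := Real.exp_pos (-w)
          nlinarith [Int.fract_lt_one y, Real.exp_le_one_iff.2 (neg_nonpos.2 hw0)]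
    _ = Real.exp (-(w * y) / 2) := by
        rw [← Real.exp_add]
        congr 1
        conv_rhs => rw [hy']
        ring

variable {n : ℕ}

/-- The law of the seed: independent uniform thresholds. -/
def thresholdLaw (n : ℕ) : Measure (Fin n → ℝ) := Measure.pi fun _ => uniformUnit

instance : IsProbabilityMeasure (thresholdLaw n) := by
  unfold thresholdLaw
  infer_instance

theorem integral_thresholdRound_apply (y : ℝ) (i : Fin n) :
    Integrable (fun θ : Fin n → ℝ => (thresholdRound y (θ i) : ℝ)) (thresholdLaw n) ∧
    ∫ θ, (thresholdRound y (θ i) : ℝ) ∂thresholdLaw n = y := by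
  have hmp : MeasurePreserving (Function.eval i) (thresholdLaw n) uniformUnit :=
    measurePreserving_eval (fun _ : Fin n => uniformUnit) i
  obtain ⟨h1, h2⟩ := integral_thresholdRound y
  refine ⟨hmp.integrable_comp_of_integrable h1, ?_⟩
  refine Eq.trans ?_ h2
  rw [← hmp.map_eq, integral_map hmp.measurable.aemeasurable]
  · rw [hmp.map_eq]; exact h1.aestronglyMeasurable

/-- Exponential bound for the lower tail of the rounded weighted sum. -/
theorem integral_le_exp_of_imp {w y : Fin n → ℝ} (hw0 : ∀ i, 0 ≤ w i) (hw1 : ∀ i, w i ≤ 1)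
    (hy : ∀ i, 0 ≤ y i) {M : ℝ} (hM : M ≤ ∑ i, w i * y i) {p : (Fin n → ℝ) → Prop}
    [DecidablePred p] (hp : MeasurableSet {θ | p θ})
    (himp : ∀ θ, p θ → ∑ i, w i * (thresholdRound (y i) (θ i) : ℝ) ≤ 1) :
    ∫ θ, (if p θ then (1 : ℝ) else 0) ∂thresholdLaw n ≤ Real.exp (1 - M / 2) := by
  have hprod (θ : Fin n → ℝ) : Real.exp (1 - ∑ i, w i * (thresholdRound (y i) (θ i) : ℝ)) =
      Real.exp 1 * ∏ i, Real.exp (-(w i * thresholdRound (y i) (θ i))) := by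
    rw [← Real.exp_sum, ← Real.exp_add, Finset.sum_neg_distrib, sub_eq_add_neg]
  have hmeas : Measurable fun θ : Fin n → ℝ =>
      Real.exp (1 - ∑ i, w i * (thresholdRound (y i) (θ i) : ℝ)) := by
    refine Real.measurable_exp.comp (measurable_const.sub (Finset.measurable_sum _ fun i _ =>
      measurable_const.mul ?_))
    exact (measurable_from_top (f := fun z : ℤ => (z : ℝ))).comp
      ((measurable_thresholdRound (y i)).comp (measurable_pi_apply i))
  have hint : Integrable (fun θ : Fin n → ℝ =>
      Real.exp (1 - ∑ i, w i * (thresholdRound (y i) (θ i) : ℝ))) (thresholdLaw n) := by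
    refine Integrable.of_bound hmeas.aestronglyMeasurable (Real.exp 1)
      (Filter.Eventually.of_forall fun θ => ?_)
    rw [Real.norm_eq_abs, abs_of_pos (Real.exp_pos _)]
    refine Real.exp_le_exp.2 (sub_le_self _ (Finset.sum_nonneg fun i _ => mul_nonneg (hw0 i) ?_))
    exact_mod_cast thresholdRound_nonneg (hy i) _
  have hite : Integrable (fun θ => if p θ then (1 : ℝ) else 0) (thresholdLaw n) := by
    refine Integrable.of_bound
      (Measurable.ite hp measurable_const measurable_const).aestronglyMeasurable 1
      (Filter.Eventually.of_forall fun θ => ?_)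
    split_ifs <;> simp
  calc ∫ θ, (if p θ then (1 : ℝ) else 0) ∂thresholdLaw n
      ≤ ∫ θ, Real.exp (1 - ∑ i, w i * (thresholdRound (y i) (θ i) : ℝ)) ∂thresholdLaw n := by
        refine integral_mono hite hint fun θ => ?_
        dsimp only
        split_ifs with h
        · exact Real.one_le_exp (by linarith [himp θ h])
        · exact (Real.exp_pos _).le
    _ = Real.exp 1 * ∏ i, ∫ t, Real.exp (-(w i * thresholdRound (y i) t)) ∂uniformUnit := by
        simp_rw [hprod]
        rw [integral_const_mul, thresholdLaw, integral_fintype_prod_eq_prod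
          (f := fun i t => Real.exp (-(w i * thresholdRound (y i) t)))]
    _ ≤ Real.exp 1 * ∏ i, Real.exp (-(w i * y i) / 2) := by
        refine mul_le_mul_of_nonneg_left (Finset.prod_le_prod (fun i _ => ?_) fun i _ => ?_)
          (Real.exp_pos _).le
        · exact integral_nonneg fun t => (Real.exp_pos _).le
        · exact integral_exp_neg_thresholdRound_le (hw0 i) (hw1 i) (hy i)
    _ ≤ Real.exp (1 - M / 2) := by
        rw [← Real.exp_sum, ← Real.exp_add]
        refine Real.exp_le_exp.2 ?_
        rw [← Finset.sum_div, Finset.sum_neg_distrib]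
        linarith

/-- The rounded vector, cut off at the upper bounds. -/
def roundVec (v : Fin n → ℤ) (α : ℝ) (x θ : Fin n → ℝ) (i : Fin n) : ℤ :=
  min (v i) (thresholdRound (α * x i) (θ i))

theorem measurable_roundVec (v : Fin n → ℤ) (α : ℝ) (x : Fin n → ℝ) :
    Measurable (roundVec v α x) :=
  measurable_pi_lambda _ fun i =>
    measurable_const.min ((measurable_thresholdRound _).comp (measurable_pi_apply i))

/-- The rounded vector does not satisfy the row `r`. -/
def RoundFails (r : Fin n → ℝ) (v : Fin n → ℤ) (α : ℝ) (x θ : Fin n → ℝ) : Prop :=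
  ∑ i, r i * (roundVec v α x θ i : ℝ) < 1

theorem measurableSet_roundFails (r : Fin n → ℝ) (v : Fin n → ℤ) (α : ℝ) (x : Fin n → ℝ) :
    MeasurableSet {θ | RoundFails r v α x θ} := by
  refine measurableSet_lt (Finset.measurable_sum _ fun i _ => measurable_const.mul ?_)
    measurable_const
  exact (measurable_from_top (f := fun z : ℤ => (z : ℝ))).comp
    ((measurable_pi_apply i).comp (measurable_roundVec v α x))

open Classical in
-- Saturated variables round to exactly `v`, and for the others the cut-off is inactive. Failure
-- therefore means that the unsaturated part misses the residual demand b. With weights min (r i) b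
-- / b, which are at most 1, the rounded sum is then at most 1, whereas `HalfCovers` makes its mean
-- at least α/2.
theorem integral_roundFails_le {r : Fin n → ℝ} {v : Fin n → ℤ} {α : ℝ} {x : Fin n → ℝ}
    (hr : ∀ i, 0 ≤ r i) (hα : 0 ≤ α) (hx : ∀ i, 0 ≤ x i) (hcov : HalfCovers r v α x) :
    ∫ θ, (if RoundFails r v α x θ then (1 : ℝ) else 0) ∂thresholdLaw n ≤
      Real.exp (1 - α / 4) := by
  have hsat (θ : Fin n → ℝ) (i) (hi : i ∈ saturated v α x) : roundVec v α x θ i = v i := by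
    simp only [saturated, Finset.mem_filter, Finset.mem_univ, true_and] at hi
    exact min_eq_left ((Int.le_floor.2 hi).trans (floor_le_thresholdRound _ _))
  have hunsat (θ : Fin n → ℝ) (i) (hi : i ∈ (saturated v α x)ᶜ) :
      roundVec v α x θ i = thresholdRound (α * x i) (θ i) := by
    simp only [saturated, Finset.mem_compl, Finset.mem_filter, Finset.mem_univ, true_and,
      not_le] at hi
    have h1 : ⌊α * x i⌋ < v i := Int.floor_lt.2 hi
    have h2 := thresholdRound_le_floor_add_one (α * x i) (θ i)
    exact min_eq_right (by omega)
  have hαx (i) : 0 ≤ α * x i := mul_nonneg hα (hx i)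
  have hround (θ : Fin n → ℝ) (i) : (0 : ℝ) ≤ thresholdRound (α * x i) (θ i) := by
    exact_mod_cast thresholdRound_nonneg (hαx i) _
  have hsplit (θ : Fin n → ℝ) : ∑ i, r i * (roundVec v α x θ i : ℝ) =
      (1 - residualDemand r v α x) +
        ∑ i ∈ (saturated v α x)ᶜ, r i * (thresholdRound (α * x i) (θ i) : ℝ) := by
    rw [← Finset.sum_add_sum_compl (saturated v α x), residualDemand, sub_sub_cancel]
    congr 1
    · exact Finset.sum_congr rfl fun i hi => by rw [hsat θ i hi]
    · exact Finset.sum_congr rfl fun i hi => by rw [hunsat θ i hi]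
  set b := residualDemand r v α x with hb
  by_cases hb0 : b ≤ 0
  · have hno (θ : Fin n → ℝ) : ¬ RoundFails r v α x θ := by
      unfold RoundFails
      rw [hsplit θ]
      have : 0 ≤ ∑ i ∈ (saturated v α x)ᶜ, r i * (thresholdRound (α * x i) (θ i) : ℝ) :=
        Finset.sum_nonneg fun i _ => mul_nonneg (hr i) (hround θ i)
      linarith
    simp only [hno, if_false, integral_zero]
    exact (Real.exp_pos _).le
  push Not at hb0
  have hcov' := hcov hb0
  have hsum (f : Fin n → ℝ) :
      ∑ i, (if i ∈ (saturated v α x)ᶜ then min (r i) b / b else 0) * f i =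
        (∑ i ∈ (saturated v α x)ᶜ, min (r i) b * f i) / b := by
    rw [Finset.sum_div, ← Finset.sum_subset (Finset.subset_univ (saturated v α x)ᶜ)]
    · exact Finset.sum_congr rfl fun i hi => by rw [if_pos hi]; ring
    · intro i _ hi
      rw [if_neg hi, zero_mul]
  have := integral_le_exp_of_imp
    (w := fun i => if i ∈ (saturated v α x)ᶜ then min (r i) b / b else 0)
    (y := fun i => α * x i) (M := α / 2) (p := RoundFails r v α x)
    (fun i => by
      split_ifs
      · exact div_nonneg (le_min (hr i) hb0.le) hb0.le
      · exact le_rfl)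
    (fun i => by
      split_ifs
      · exact div_le_one_of_le₀ (min_le_right _ _) hb0.le
      · exact zero_le_one) hαx
    (by
      rw [hsum, le_div_iff₀ hb0]
      have : ∑ i ∈ (saturated v α x)ᶜ, min (r i) b * (α * x i) =
          α * ∑ i ∈ (saturated v α x)ᶜ, min (r i) b * x i := by
        rw [Finset.mul_sum]
        exact Finset.sum_congr rfl fun i _ => by ring
      rw [this]
      nlinarith)
    (measurableSet_roundFails r v α x)
    (fun θ hθ => by
      rw [hsum, div_le_one hb0]
      unfold RoundFails at hθ
      rw [hsplit θ] at hθ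
      have : ∑ i ∈ (saturated v α x)ᶜ, min (r i) b * (thresholdRound (α * x i) (θ i) : ℝ) ≤
          ∑ i ∈ (saturated v α x)ᶜ, r i * (thresholdRound (α * x i) (θ i) : ℝ) :=
        Finset.sum_le_sum fun i _ => mul_le_mul_of_nonneg_right (min_le_left _ _) (hround θ i)
      linarith)
  refine this.trans (le_of_eq ?_)
  congr 1
  ring

end

/-! ### The online algorithm -/

noncomputable section

variable {n : ℕ}

/-- `z` is a cheapest integral solution of the row `r` alone. -/
structure IsOptRowSolution (r c : Fin n → ℝ) (v z : Fin n → ℤ) : Prop where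
  solution : RowSolution r v z
  le : ∀ i, z i ≤ v i
  cost_le : ∀ X, RowSolution r v X → (∀ i, X i ≤ v i) → ∑ i, c i * (z i : ℝ) ≤ ∑ i, c i * (X i : ℝ)

theorem exists_isOptRowSolution {r : Fin n → ℝ} (c : Fin n → ℝ) {v X : Fin n → ℤ}
    (hX : RowSolution r v X) (hXv : ∀ i, X i ≤ v i) : ∃ z, IsOptRowSolution r c v z := by
  have hfin : Set.Finite {X | RowSolution r v X ∧ ∀ i, X i ≤ v i} :=
    (Set.finite_Icc (0 : Fin n → ℤ) v).subset fun X hX => ⟨hX.1.1, hX.2⟩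
  obtain ⟨z, hz, hmin⟩ := Set.exists_min_image _ (fun X => ∑ i, c i * (X i : ℝ)) hfin
    ⟨X, hX, hXv⟩
  exact ⟨z, hz.1, hz.2, fun X hX hXv => hmin X ⟨hX, hXv⟩⟩

open Classical in
/-- A cheapest integral solution of the row `r` alone, if there is one. -/
def optRowSolution (r c : Fin n → ℝ) (v : Fin n → ℤ) : Fin n → ℤ :=
  if h : ∃ z, IsOptRowSolution r c v z then h.choose else 0

open Classical in
/-- The fractional update, if there is one. -/
def fracUpdate (r c : Fin n → ℝ) (v : Fin n → ℤ) (α : ℝ) (x : Fin n → ℝ) : Fin n → ℝ :=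
  if h : ∃ y, IsFracUpdate r c v α x y then h.choose else x

theorem le_fracUpdate (r c : Fin n → ℝ) (v : Fin n → ℤ) (α : ℝ) (x : Fin n → ℝ) (i : Fin n) :
    x i ≤ fracUpdate r c v α x i := by
  unfold fracUpdate
  split_ifs with h
  · exact h.choose_spec.le i
  · exact le_rfl

namespace CIP

/-- The row that arrives at time `t`. -/
def row (P : CIP n) (t : ℕ) : Fin n → ℝ := P.rows.getD t 0

/-- The costs of the variables in the row `t`. -/
def rowCost (P : CIP n) (t : ℕ) (i : Fin n) : ℝ := if P.row t i = 0 then 0 else P.cost i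

/-- The integral upper bounds of the variables in the row `t`. -/
def rowBound (P : CIP n) (t : ℕ) (i : Fin n) : ℤ := if P.row t i = 0 then 0 else ⌊P.bound i⌋

/-- The factor by which the fractional solution is scaled before rounding. -/
def scale (P : CIP n) (t : ℕ) : ℝ := 4 + 8 * Real.log ((P.truncate (t + 1)).colSparsity : ℝ)

/-- The fractional solution after `t` rows. -/
def frac (P : CIP n) : ℕ → Fin n → ℝ
  | 0 => 0
  | t + 1 => fracUpdate (P.row t) (P.rowCost t) (P.rowBound t) (P.scale t) (P.frac t)

open Classical in
/-- The integral vector computed for the row `t`: the rounded fractional solution, completed by a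
cheapest solution of the row if the rounding fails. -/
def patch (P : CIP n) (t : ℕ) (θ : Fin n → ℝ) (i : Fin n) : ℤ :=
  max (roundVec (P.rowBound t) (P.scale t) (P.frac (t + 1)) θ i)
    (if RoundFails (P.row t) (P.rowBound t) (P.scale t) (P.frac (t + 1)) θ then
      optRowSolution (P.row t) (P.rowCost t) (P.rowBound t) i else 0)

/-- The integral solution held after `t` rows. -/
def hold (P : CIP n) : ℕ → (Fin n → ℝ) → Fin n → ℤ
  | 0, _, _ => 0
  | t + 1, θ, i => max (P.hold t θ i) (P.patch t θ i)

/-- The online property: all data used for row `s` can be read off any visible history that includes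
this row. -/
theorem truncate_visible_congr (P : CIP n) {s t : ℕ} (h : s < t) :
    (P.truncate t).visible.row s = P.row s ∧ (P.truncate t).visible.rowCost s = P.rowCost s ∧
    (P.truncate t).visible.rowBound s = P.rowBound s ∧
    (P.truncate t).visible.scale s = P.scale s := by
  have hrow : (P.truncate t).visible.row s = P.row s := by
    simp [row, visible, truncate, List.getD, h]
  have happ (i) (hi : P.row s i ≠ 0) : (P.truncate t).Appears i := by
    refine ⟨P.row s, ?_, hi⟩
    have hs : s < P.rows.length := by
      -- Past the end of the list `row` takes the default value 0, in which no variable appears.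
      by_contra hs
      rw [row, List.getD_eq_default _ _ (by omega)] at hi
      exact hi rfl
    have hs' : s < (P.rows.take t).length := by simp [h, hs]
    have e : P.row s = (P.rows.take t)[s] := by
      rw [row, List.getD_eq_getElem _ _ hs, List.getElem_take]
    rw [e]
    exact List.getElem_mem hs'
  refine ⟨hrow, ?_, ?_, ?_⟩
  · ext i
    simp only [rowCost, hrow]
    split_ifs with hi
    · rfl
    · exact if_pos (happ i hi)
  · ext i
    simp only [rowBound, hrow]
    split_ifs with hi
    · rfl
    · exact congrArg Int.floor (if_pos (happ i hi))
  · have : ((P.truncate t).visible.truncate (s + 1)).rows = (P.truncate (s + 1)).rows := by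
      simp only [truncate, visible, List.take_take]
      rw [min_eq_left (by omega)]
    simp only [scale, colSparsity, this]

theorem frac_truncate_visible (P : CIP n) {s t : ℕ} (h : s ≤ t) :
    (P.truncate t).visible.frac s = P.frac s := by
  induction s with
  | zero => rfl
  | succ s ih =>
    obtain ⟨h1, h2, h3, h4⟩ := P.truncate_visible_congr (s := s) (t := t) (by omega)
    simp only [frac, h1, h2, h3, h4, ih (by omega)]

theorem hold_truncate_visible (P : CIP n) {s t : ℕ} (h : s ≤ t) (θ : Fin n → ℝ) :
    (P.truncate t).visible.hold s θ = P.hold s θ := by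
  induction s with
  | zero => rfl
  | succ s ih =>
    obtain ⟨h1, h2, h3, h4⟩ := P.truncate_visible_congr (s := s) (t := t) (by omega)
    have hpatch : (P.truncate t).visible.patch s θ = P.patch s θ := by
      unfold patch
      rw [h1, h2, h3, h4, P.frac_truncate_visible h]
    ext i
    simp only [hold, hpatch, ih (by omega)]

theorem measurable_hold (P : CIP n) (t : ℕ) : Measurable (P.hold t) := by
  induction t with
  | zero => exact measurable_const
  | succ t ih =>
    refine measurable_pi_lambda _ fun i => ((measurable_pi_apply i).comp ih).max ?_
    refine ((measurable_pi_apply i).comp (measurable_roundVec _ _ _)).max ?_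
    exact Measurable.ite (measurableSet_roundFails _ _ _ _) measurable_const measurable_const

/-- Scaled threshold rounding of the fractional solution, with completion of the failing rows. -/
def onlineAlgorithm (n : ℕ) : RandomizedOnlineAlgorithm n where
  Ω := Fin n → ℝ
  μ := thresholdLaw n
  output H := H.hold H.rows.length
  measurable_output H := H.measurable_hold _

/-- The output replays the whole run from the visible history, whose length tells the current time.
-/
theorem onlineAlgorithm_solution (P : CIP n) {t : ℕ} (ht : t ≤ P.rows.length)
    (θ : (onlineAlgorithm n).Ω) : (onlineAlgorithm n).solution P t θ = P.hold t θ := by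
  have : (P.truncate t).visible.rows.length = t := by simp [visible, truncate, ht]
  change (P.truncate t).visible.hold (P.truncate t).visible.rows.length θ = _
  rw [this]
  exact P.hold_truncate_visible le_rfl θ

/-! ### Feasibility and monotonicity -/

theorem row_nonneg (P : CIP n) (t : ℕ) (i : Fin n) : 0 ≤ P.row t i := by
  unfold row
  by_cases h : t < P.rows.length
  · rw [List.getD_eq_getElem _ _ h]
    exact P.rows_nonneg _ (List.getElem_mem h) i
  · rw [List.getD_eq_default _ _ (by omega)]
    exact le_rfl

theorem rowCost_nonneg (P : CIP n) (t : ℕ) (i : Fin n) : 0 ≤ P.rowCost t i := by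
  unfold rowCost
  split_ifs
  · exact le_rfl
  · exact P.cost_nonneg i

theorem rowBound_nonneg (P : CIP n) (t : ℕ) (i : Fin n) : 0 ≤ P.rowBound t i := by
  unfold rowBound
  split_ifs
  · exact le_rfl
  · exact Int.floor_nonneg.2 (P.bound_nonneg i)

theorem rowBound_le (P : CIP n) (t : ℕ) (i : Fin n) : P.rowBound t i ≤ ⌊P.bound i⌋ := by
  unfold rowBound
  split_ifs
  · exact Int.floor_nonneg.2 (P.bound_nonneg i)
  · exact le_rfl

theorem scale_pos (P : CIP n) (t : ℕ) : 0 < P.scale t := by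
  have := Real.log_natCast_nonneg (P.truncate (t + 1)).colSparsity
  unfold scale
  linarith

theorem frac_mono (P : CIP n) : Monotone P.frac :=
  monotone_nat_of_le_succ fun _ => le_fracUpdate _ _ _ _ _

theorem frac_nonneg (P : CIP n) (t : ℕ) (i : Fin n) : 0 ≤ P.frac t i :=
  P.frac_mono t.zero_le i

theorem row_mem (P : CIP n) {t : ℕ} (ht : t < P.rows.length) : P.row t ∈ P.rows := by
  rw [row, List.getD_eq_getElem _ _ ht]
  exact List.getElem_mem ht

theorem IsSolution.rowSolution {P : CIP n} {X : Fin n → ℤ} (hX : P.IsSolution X) {t : ℕ}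
    (ht : t < P.rows.length) : RowSolution (P.row t) (P.rowBound t) X :=
  ⟨fun i => (hX.1 i).1, fun i hi => by
    rw [rowBound, if_neg hi]
    exact Int.le_floor.2 (hX.1 i).2, hX.2 _ (P.row_mem ht)⟩

/-- Setting the variables outside the row to 0 respects `rowBound` everywhere, as `IsOptRowSolution`
requires of its competitors, and keeps the row cost. -/
theorem exists_restrict {P : CIP n} {X : Fin n → ℤ} (hX : P.IsSolution X) {t : ℕ}
    (ht : t < P.rows.length) : ∃ Y, RowSolution (P.row t) (P.rowBound t) Y ∧
      (∀ i, Y i ≤ P.rowBound t i) ∧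
      ∑ i, P.rowCost t i * (Y i : ℝ) = ∑ i, P.rowCost t i * (X i : ℝ) := by
  obtain ⟨h1, h2, h3⟩ := hX.rowSolution ht
  refine ⟨fun i => if P.row t i = 0 then 0 else X i, ⟨fun i => ?_, fun i hi => ?_, ?_⟩,
    fun i => ?_, ?_⟩
  · dsimp only
    split_ifs
    exacts [le_rfl, h1 i]
  · simp only [if_neg hi]
    exact h2 i hi
  · refine h3.trans (le_of_eq (Finset.sum_congr rfl fun i _ => ?_))
    dsimp only
    split_ifs with h <;> simp [h]
  · dsimp only
    split_ifs with h
    exacts [P.rowBound_nonneg t i, h2 i h]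
  · refine Finset.sum_congr rfl fun i _ => ?_
    dsimp only
    split_ifs with h <;> simp [rowCost, h]

theorem isOptRowSolution (P : CIP n) (hP : P.Feasible) {t : ℕ} (ht : t < P.rows.length) :
    IsOptRowSolution (P.row t) (P.rowCost t) (P.rowBound t)
      (optRowSolution (P.row t) (P.rowCost t) (P.rowBound t)) := by
  obtain ⟨X, hX⟩ := hP
  obtain ⟨Y, hY, hYv, -⟩ := exists_restrict hX ht
  have h := exists_isOptRowSolution (P.rowCost t) hY hYv
  rw [optRowSolution, dif_pos h]
  exact h.choose_spec

theorem isFracUpdate (P : CIP n) (hP : P.Feasible) {t : ℕ} (ht : t < P.rows.length) :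
    IsFracUpdate (P.row t) (P.rowCost t) (P.rowBound t) (P.scale t) (P.frac t)
      (P.frac (t + 1)) := by
  obtain ⟨X, hX⟩ := hP
  have h := exists_isFracUpdate (P.row_nonneg t) (P.rowCost_nonneg t) (P.scale_pos t)
    (P.frac_nonneg t) (hX.rowSolution ht)
  rw [frac, fracUpdate, dif_pos h]
  exact h.choose_spec

theorem patch_le (P : CIP n) (hP : P.Feasible) {t : ℕ} (ht : t < P.rows.length)
    (θ : Fin n → ℝ) (i : Fin n) : P.patch t θ i ≤ ⌊P.bound i⌋ := by
  refine le_trans (max_le (min_le_left _ _) ?_) (P.rowBound_le t i)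
  split_ifs
  exacts [(P.isOptRowSolution hP ht).le i, P.rowBound_nonneg t i]

theorem one_le_sum_patch (P : CIP n) (hP : P.Feasible) {t : ℕ} (ht : t < P.rows.length)
    (θ : Fin n → ℝ) : 1 ≤ ∑ i, P.row t i * (P.patch t θ i : ℝ) := by
  by_cases hf : RoundFails (P.row t) (P.rowBound t) (P.scale t) (P.frac (t + 1)) θ
  · refine (P.isOptRowSolution hP ht).solution.2.2.trans (Finset.sum_le_sum fun i _ =>
      mul_le_mul_of_nonneg_left (Int.cast_le.2 ?_) (P.row_nonneg t i))
    rw [patch, if_pos hf]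
    exact le_max_right _ _
  · refine (not_lt.1 hf).trans (Finset.sum_le_sum fun i _ =>
      mul_le_mul_of_nonneg_left (Int.cast_le.2 (le_max_left _ _)) (P.row_nonneg t i))

theorem hold_mono (P : CIP n) (θ : Fin n → ℝ) : Monotone fun t => P.hold t θ :=
  monotone_nat_of_le_succ fun _ _ => le_max_left _ _

theorem hold_le (P : CIP n) (hP : P.Feasible) (θ : Fin n → ℝ) (i : Fin n) {t : ℕ}
    (ht : t ≤ P.rows.length) : P.hold t θ i ≤ ⌊P.bound i⌋ := by
  induction t with
  | zero => exact Int.floor_nonneg.2 (P.bound_nonneg i)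
  | succ t ih => exact max_le (ih (by omega)) (P.patch_le hP ht θ i)

theorem hold_isSolution (P : CIP n) (hP : P.Feasible) (θ : Fin n → ℝ) {t : ℕ}
    (ht : t ≤ P.rows.length) : (P.truncate t).IsSolution (P.hold t θ) := by
  refine ⟨fun i => ⟨P.hold_mono θ t.zero_le i, Int.le_floor.1 (P.hold_le hP θ i ht)⟩, ?_⟩
  intro r hr
  obtain ⟨s, hs, rfl⟩ := List.getElem_of_mem hr
  have hs' : s < t ∧ s < P.rows.length := by simpa [truncate] using hs
  have e : (P.truncate t).rows[s] = P.row s := by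
    rw [row, List.getD_eq_getElem _ _ hs'.2]
    exact List.getElem_take
  rw [e]
  refine (P.one_le_sum_patch hP hs'.2 θ).trans (Finset.sum_le_sum fun i _ =>
    mul_le_mul_of_nonneg_left (Int.cast_le.2 ?_) (P.row_nonneg s i))
  exact (le_max_right _ _).trans (P.hold_mono θ hs'.1 i)

/-! ### Cost of the fractional solution -/

theorem card_rowSupport_le (P : CIP n) {t : ℕ} (ht : t < P.rows.length) :
    (rowSupport (P.row t)).card ≤ P.rowSparsity := by
  have h (l : List (Fin n → ℝ)) (r) (hr : r ∈ l) : (rowSupport r).card ≤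
      (l.map fun r => (Finset.univ.filter fun i => r i ≠ 0).card).foldr max 0 := by
    induction l with
    | nil => simp at hr
    | cons a l ih =>
      simp only [List.map_cons, List.foldr_cons]
      rcases List.mem_cons.1 hr with rfl | hr
      · exact le_max_left _ _
      · exact (ih hr).trans (le_max_right _ _)
  exact h _ _ (P.row_mem ht)

/-- The cost of the fractional solution is bounded by the potential. -/
theorem sum_cost_frac_le_potential (P : CIP n) {X : Fin n → ℤ} (hX : P.IsSolution X) {t : ℕ}
    (ht : t ≤ P.rows.length) {k : ℕ} (hk : 2 ≤ k) (hPk : P.rowSparsity ≤ k) :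
    ∑ i, P.cost i * P.frac t i ≤ 12 * ∑ i, P.cost i *
      (coverPotential k (X i) (P.frac t i) - coverPotential k (X i) 0) := by
  induction t with
  | zero => simp [frac]
  | succ t ih =>
    have ih := ih (by omega)
    have hu := P.isFracUpdate ⟨X, hX⟩ ht
    have h := hu.paidFor X (hX.rowSolution ht) k hk ((P.card_rowSupport_le ht).trans hPk)
    -- Outside the row nothing changes, so the hidden costs may be restored.
    have hmask (f : Fin n → ℝ → ℝ) :
        ∑ i, P.rowCost t i * (f i (P.frac (t + 1) i) - f i (P.frac t i)) =
          ∑ i, P.cost i * (f i (P.frac (t + 1) i) - f i (P.frac t i)) := by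
      refine Finset.sum_congr rfl fun i _ => ?_
      unfold rowCost
      split_ifs with hi
      · rw [hu.eq_of_eq_zero i hi]; simp
      · rfl
    rw [hmask fun _ a => a, hmask fun i a => coverPotential k (X i) a] at h
    have e1 : ∑ i, P.cost i * P.frac (t + 1) i = ∑ i, P.cost i * P.frac t i +
        ∑ i, P.cost i * (P.frac (t + 1) i - P.frac t i) := by
      rw [← Finset.sum_add_distrib]
      exact Finset.sum_congr rfl fun i _ => by ring
    have e2 : ∑ i, P.cost i *
          (coverPotential k (X i) (P.frac (t + 1) i) - coverPotential k (X i) 0) =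
        ∑ i, P.cost i * (coverPotential k (X i) (P.frac t i) - coverPotential k (X i) 0) +
        ∑ i, P.cost i * (coverPotential k (X i) (P.frac (t + 1) i) -
          coverPotential k (X i) (P.frac t i)) := by
      rw [← Finset.sum_add_distrib]
      exact Finset.sum_congr rfl fun i _ => by ring
    rw [e1, e2]
    linarith

theorem sum_cost_frac_le (P : CIP n) {X : Fin n → ℤ} (hX : P.IsSolution X) {k : ℕ} (hk : 2 ≤ k)
    (hPk : P.rowSparsity ≤ k) :
    ∑ i, P.cost i * P.frac P.rows.length i ≤ 12 * Real.log k * P.value X := by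
  refine (P.sum_cost_frac_le_potential hX le_rfl hk hPk).trans ?_
  rw [mul_assoc, value, Finset.mul_sum (a := Real.log k)]
  refine mul_le_mul_of_nonneg_left (Finset.sum_le_sum fun i _ => ?_) (by norm_num : (0 : ℝ) ≤ 12)
  have h1 := coverPotential_nonpos (k := k) (by omega)
    (by exact_mod_cast (hX.1 i).1 : (0 : ℝ) ≤ X i) (P.frac_nonneg P.rows.length i)
  rw [coverPotential_zero]
  nlinarith [P.cost_nonneg i]

/-! ### Cost of completing failing rows -/

/-- The number of the first `t` rows in which the variable `i` appears. -/
def appearances (P : CIP n) (i : Fin n) (t : ℕ) : ℕ :=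
  (P.rows.take t).countP fun r => decide (r i ≠ 0)

theorem appearances_le_colSparsity (P : CIP n) (i : Fin n) (t : ℕ) :
    P.appearances i t ≤ (P.truncate t).colSparsity :=
  Finset.le_sup (f := fun i : Fin n => (P.rows.take t).countP fun r : Fin n → ℝ => decide (r i ≠ 0))
    (Finset.mem_univ i)

theorem appearances_succ (P : CIP n) (i : Fin n) {t : ℕ} (ht : t < P.rows.length) :
    P.appearances i (t + 1) = P.appearances i t + if P.row t i = 0 then 0 else 1 := by
  unfold appearances
  rw [List.take_add_one, List.getElem?_eq_getElem ht, row, List.getD_eq_getElem _ _ ht,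
    List.countP_append]
  by_cases h : P.rows[t] i = 0 <;> simp [h]

theorem colSparsity_truncate_le (P : CIP n) (t : ℕ) :
    (P.truncate t).colSparsity ≤ P.colSparsity :=
  Finset.sup_mono_fun fun _ _ => (List.take_sublist t P.rows).countP_le

/-- Along the rows of a variable, the reciprocal squares of the column sparsities are summable. -/
theorem sum_inv_sq_le_two (P : CIP n) (i : Fin n) {t : ℕ} (ht : t ≤ P.rows.length) :
    ∑ s ∈ Finset.range t, (if P.row s i = 0 then 0 else
      (((P.truncate (s + 1)).colSparsity : ℝ) ^ 2)⁻¹) ≤ 2 - 2 / (P.appearances i t + 1) := by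
  induction t with
  | zero => simp [appearances]
  | succ t ih =>
    have ih := ih (by omega)
    have ha := P.appearances_succ i ht
    have hl := P.appearances_le_colSparsity i (t + 1)
    rw [Finset.sum_range_succ]
    split_ifs at ha ⊢ with h
    · rw [ha]
      simpa using ih
    · rw [ha] at hl ⊢
      set N := P.appearances i t
      have hl' : (N : ℝ) + 1 ≤ (P.truncate (t + 1)).colSparsity := by exact_mod_cast hl
      have hN : (0 : ℝ) ≤ N := by positivity
      have h1 : (((P.truncate (t + 1)).colSparsity : ℝ) ^ 2)⁻¹ ≤ (((N : ℝ) + 1) ^ 2)⁻¹ := by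
        gcongr
      -- This is the `N + 1`-st appearance of the variable, so the current column sparsity is at
      -- least `N + 1`; the bound telescopes.
      have h2 : (((N : ℝ) + 1) ^ 2)⁻¹ ≤ 2 / ((N : ℝ) + 1) - 2 / ((N : ℝ) + 1 + 1) := by
        rw [div_sub_div _ _ (by positivity) (by positivity), inv_eq_one_div,
          div_le_div_iff₀ (by positivity) (by positivity)]
        nlinarith [mul_nonneg hN hN, mul_nonneg hN (mul_nonneg hN hN)]
      push_cast
      linarith

open Classical in
/-- The indicator of the event that the rounding fails at the row `t`. -/
def failIndicator (P : CIP n) (t : ℕ) (θ : Fin n → ℝ) : ℝ :=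
  if RoundFails (P.row t) (P.rowBound t) (P.scale t) (P.frac (t + 1)) θ then 1 else 0

theorem integrable_failIndicator (P : CIP n) (t : ℕ) :
    Integrable (P.failIndicator t) (thresholdLaw n) := by
  refine Integrable.of_bound (Measurable.ite (measurableSet_roundFails _ _ _ _) measurable_const
    measurable_const).aestronglyMeasurable 1 (Filter.Eventually.of_forall fun θ => ?_)
  unfold failIndicator
  split_ifs <;> simp

theorem colSparsity_truncate_pos (P : CIP n) (hP : P.Feasible) {t : ℕ}
    (ht : t < P.rows.length) : 0 < (P.truncate (t + 1)).colSparsity := by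
  obtain ⟨X, hX⟩ := hP
  have h1 := (hX.rowSolution ht).2.2
  obtain ⟨i, hi⟩ : ∃ i, P.row t i ≠ 0 := by
    by_contra! h
    simp [h] at h1
    linarith
  have := P.appearances_succ i ht
  rw [if_neg hi] at this
  have := P.appearances_le_colSparsity i (t + 1)
  omega

/-- The constants 4 and 8 in `scale` are chosen so that exp(1 - α/4) is exactly ℓ_t⁻². Positivity of
ℓ_t holds because a zero row is infeasible. -/
theorem integral_failIndicator_le (P : CIP n) (hP : P.Feasible) {t : ℕ}
    (ht : t < P.rows.length) :
    ∫ θ, P.failIndicator t θ ∂thresholdLaw n ≤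
      (((P.truncate (t + 1)).colSparsity : ℝ) ^ 2)⁻¹ := by
  have hl : (0 : ℝ) < (P.truncate (t + 1)).colSparsity := by
    exact_mod_cast P.colSparsity_truncate_pos hP ht
  refine (integral_roundFails_le (P.row_nonneg t) (P.scale_pos t).le (P.frac_nonneg _)
    (P.isFracUpdate hP ht).halfCovers).trans (le_of_eq ?_)
  have : 1 - P.scale t / 4 = -(2 * Real.log ((P.truncate (t + 1)).colSparsity : ℝ)) := by
    unfold scale
    ring
  rw [this, Real.exp_neg, two_mul, Real.exp_add, Real.exp_log hl, sq]

/-- The expected cost of completing the failing rows. -/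
theorem integral_sum_failIndicator_le (P : CIP n) {X : Fin n → ℤ} (hX : P.IsSolution X) :
    ∑ t ∈ Finset.range P.rows.length, (∫ θ, P.failIndicator t θ ∂thresholdLaw n) *
      ∑ i, P.rowCost t i * (optRowSolution (P.row t) (P.rowCost t) (P.rowBound t) i : ℝ) ≤
    2 * P.value X := by
  have hX0 (i) : (0 : ℝ) ≤ X i := by exact_mod_cast (hX.1 i).1
  calc _ ≤ ∑ t ∈ Finset.range P.rows.length, (((P.truncate (t + 1)).colSparsity : ℝ) ^ 2)⁻¹ *
        ∑ i, P.rowCost t i * (X i : ℝ) := by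
        refine Finset.sum_le_sum fun t ht => ?_
        have ht := Finset.mem_range.1 ht
        have ho := P.isOptRowSolution ⟨X, hX⟩ ht
        obtain ⟨Y, hY, hYv, hYX⟩ := exists_restrict hX ht
        rw [← hYX]
        refine mul_le_mul (P.integral_failIndicator_le ⟨X, hX⟩ ht) (ho.cost_le Y hY hYv) ?_
          (by positivity)
        exact Finset.sum_nonneg fun i _ => mul_nonneg (P.rowCost_nonneg t i)
          (by exact_mod_cast ho.solution.1 i)
    _ = ∑ i, P.cost i * X i * ∑ t ∈ Finset.range P.rows.length,
        (if P.row t i = 0 then 0 else (((P.truncate (t + 1)).colSparsity : ℝ) ^ 2)⁻¹) := by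
        simp_rw [Finset.mul_sum]
        rw [Finset.sum_comm]
        refine Finset.sum_congr rfl fun i _ => Finset.sum_congr rfl fun t _ => ?_
        unfold rowCost
        split_ifs
        · simp
        · ring
    _ ≤ ∑ i, P.cost i * X i * 2 := by
        refine Finset.sum_le_sum fun i _ => mul_le_mul_of_nonneg_left
          ((P.sum_inv_sq_le_two i le_rfl).trans (sub_le_self _ (by positivity)))
          (mul_nonneg (P.cost_nonneg i) (hX0 i))
    _ = 2 * P.value X := by
        rw [← Finset.sum_mul, mul_comm]
        rfl

/-! ### Total expected cost -/

/-- As thresholds are never redrawn, one rounding of the final fractional value at the largest scale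
dominates all earlier roundings. Its mean is just `A` times that value, so the rounding is paid for
only once. -/
theorem hold_le_round_add (P : CIP n) (hP : P.Feasible) {A : ℝ} (hA : ∀ t, P.scale t ≤ A)
    (θ : Fin n → ℝ) (i : Fin n) {t : ℕ} (ht : t ≤ P.rows.length) :
    (P.hold t θ i : ℝ) ≤ thresholdRound (A * P.frac P.rows.length i) (θ i) +
      ∑ s ∈ Finset.range t, P.failIndicator s θ *
        (optRowSolution (P.row s) (P.rowCost s) (P.rowBound s) i : ℝ) := by
  have hA0 : 0 ≤ A := (P.scale_pos 0).le.trans (hA 0)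
  have hR : (0 : ℝ) ≤ thresholdRound (A * P.frac P.rows.length i) (θ i) := by
    exact_mod_cast thresholdRound_nonneg (mul_nonneg hA0 (P.frac_nonneg _ i)) _
  have hz (s) (hs : s < P.rows.length) : 0 ≤ P.failIndicator s θ *
      (optRowSolution (P.row s) (P.rowCost s) (P.rowBound s) i : ℝ) := by
    refine mul_nonneg ?_ (by exact_mod_cast (P.isOptRowSolution hP hs).solution.1 i)
    unfold failIndicator
    split_ifs <;> simp
  have hS (m) (hm : m ≤ P.rows.length) : 0 ≤ ∑ s ∈ Finset.range m, P.failIndicator s θ *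
      (optRowSolution (P.row s) (P.rowCost s) (P.rowBound s) i : ℝ) :=
    Finset.sum_nonneg fun s hs => hz s (by have := Finset.mem_range.1 hs; omega)
  induction t with
  | zero => simpa [hold] using hR
  | succ t ih =>
    have ih := ih (by omega)
    have h0 := hz t ht
    have hSt := hS t (by omega)
    rw [Finset.sum_range_succ]
    simp only [hold, patch, Int.cast_max]
    refine max_le (by linarith) (max_le ?_ ?_)
    · have : roundVec (P.rowBound t) (P.scale t) (P.frac (t + 1)) θ i ≤
          thresholdRound (A * P.frac P.rows.length i) (θ i) :=
        (min_le_right _ _).trans (thresholdRound_mono (mul_le_mul (hA t) (P.frac_mono ht i)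
          (P.frac_nonneg _ i) hA0) _)
      have : (roundVec (P.rowBound t) (P.scale t) (P.frac (t + 1)) θ i : ℝ) ≤
          thresholdRound (A * P.frac P.rows.length i) (θ i) := by exact_mod_cast this
      linarith
    · split_ifs with hf
      · have : P.failIndicator t θ = 1 := if_pos hf
        rw [this, one_mul]
        linarith
      · rw [Int.cast_zero]
        linarith

theorem integrable_value_hold (P : CIP n) (hP : P.Feasible) :
    Integrable (fun θ => P.value (P.hold P.rows.length θ)) (thresholdLaw n) := by
  refine integrable_finsetSum _ fun i _ => Integrable.const_mul ?_ _
  have hm : Measurable fun θ => (P.hold P.rows.length θ i : ℝ) :=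
    (measurable_from_top (f := fun z : ℤ => (z : ℝ))).comp
      ((measurable_pi_apply i).comp (P.measurable_hold _))
  refine Integrable.of_bound hm.aestronglyMeasurable (P.bound i)
    (Filter.Eventually.of_forall fun θ => ?_)
  obtain ⟨h1, h2⟩ := (P.hold_isSolution hP θ le_rfl).1 i
  rw [Real.norm_eq_abs, abs_of_nonneg (by exact_mod_cast h1)]
  exact h2

theorem integral_value_hold_le (P : CIP n) {X : Fin n → ℤ} (hX : P.IsSolution X) {A : ℝ}
    (hA : ∀ t, P.scale t ≤ A) :
    ∫ θ, P.value (P.hold P.rows.length θ) ∂thresholdLaw n ≤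
      A * ∑ i, P.cost i * P.frac P.rows.length i + 2 * P.value X := by
  set z : ℕ → Fin n → ℝ :=
    fun t i => (optRowSolution (P.row t) (P.rowCost t) (P.rowBound t) i : ℝ) with hz
  have hR (i : Fin n) := integral_thresholdRound_apply (A * P.frac P.rows.length i) i
  have hI1 : Integrable (fun θ : Fin n → ℝ => ∑ i, P.cost i *
      (thresholdRound (A * P.frac P.rows.length i) (θ i) : ℝ)) (thresholdLaw n) :=
    integrable_finsetSum _ fun i _ => (hR i).1.const_mul _
  have hI2 : Integrable (fun θ => ∑ t ∈ Finset.range P.rows.length,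
      P.failIndicator t θ * ∑ i, P.rowCost t i * z t i) (thresholdLaw n) :=
    integrable_finsetSum _ fun t _ => (P.integrable_failIndicator t).mul_const _
  have hzc (t) (ht : t < P.rows.length) (i) : P.cost i * z t i = P.rowCost t i * z t i := by
    unfold rowCost
    split_ifs with h
    · have h1 := (P.isOptRowSolution ⟨X, hX⟩ ht).le i
      have h2 := (P.isOptRowSolution ⟨X, hX⟩ ht).solution.1 i
      -- Outside the row the bound is 0, which forces the completion to vanish there.
      rw [rowBound, if_pos h] at h1
      have : z t i = 0 := by
        simp only [hz]
        exact_mod_cast le_antisymm h1 h2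
      simp [this]
    · rfl
  calc _ ≤ ∫ θ, (∑ i, P.cost i * (thresholdRound (A * P.frac P.rows.length i) (θ i) : ℝ) +
        ∑ t ∈ Finset.range P.rows.length, P.failIndicator t θ * ∑ i, P.rowCost t i * z t i)
        ∂thresholdLaw n := by
        refine integral_mono (P.integrable_value_hold ⟨X, hX⟩) (hI1.add hI2) fun θ => ?_
        have e : ∑ t ∈ Finset.range P.rows.length,
            P.failIndicator t θ * ∑ i, P.rowCost t i * z t i =
            ∑ i, P.cost i * ∑ t ∈ Finset.range P.rows.length, P.failIndicator t θ * z t i := by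
          simp_rw [Finset.mul_sum]
          rw [Finset.sum_comm]
          refine Finset.sum_congr rfl fun i _ => Finset.sum_congr rfl fun t ht => ?_
          rw [← hzc t (Finset.mem_range.1 ht) i]
          ring
        dsimp only
        rw [e, ← Finset.sum_add_distrib]
        refine Finset.sum_le_sum fun i _ => ?_
        rw [← mul_add]
        exact mul_le_mul_of_nonneg_left (P.hold_le_round_add ⟨X, hX⟩ hA θ i le_rfl)
          (P.cost_nonneg i)
    _ = A * ∑ i, P.cost i * P.frac P.rows.length i +
        ∑ t ∈ Finset.range P.rows.length, (∫ θ, P.failIndicator t θ ∂thresholdLaw n) *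
          ∑ i, P.rowCost t i * z t i := by
        rw [integral_add hI1 hI2, integral_finsetSum _ fun i _ => (hR i).1.const_mul _,
          integral_finsetSum _ fun t _ => (P.integrable_failIndicator t).mul_const _,
          Finset.mul_sum]
        congr 1
        · refine Finset.sum_congr rfl fun i _ => ?_
          rw [integral_const_mul, (hR i).2]
          ring
        · exact Finset.sum_congr rfl fun t _ => integral_mul_const _ _
    _ ≤ _ := by
        have := P.integral_sum_failIndicator_le hX
        linarith

theorem value_nonneg (P : CIP n) {X : Fin n → ℤ} (hX : P.IsSolution X) : 0 ≤ P.value X :=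
  Finset.sum_nonneg fun i _ => mul_nonneg (P.cost_nonneg i) (by exact_mod_cast (hX.1 i).1)

theorem scale_le (P : CIP n) (t : ℕ) :
    P.scale t ≤ 16 * Real.log ((max 2 P.colSparsity : ℕ) : ℝ) := by
  set L := Real.log ((max 2 P.colSparsity : ℕ) : ℝ) with hL
  have h1 : Real.log 2 ≤ L := Real.log_le_log (by norm_num) (by exact_mod_cast le_max_left _ _)
  have h2 : Real.log ((P.truncate (t + 1)).colSparsity : ℝ) ≤ L := by
    rcases Nat.eq_zero_or_pos (P.truncate (t + 1)).colSparsity with h | h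
    · rw [h, Nat.cast_zero, Real.log_zero]
      exact Real.log_natCast_nonneg _
    · refine Real.log_le_log (by exact_mod_cast h) ?_
      exact_mod_cast (P.colSparsity_truncate_le (t + 1)).trans (le_max_right _ _)
  -- The constant 4 is absorbed because L ≥ log 2 > 1/2.
  have := Real.log_two_gt_d9
  unfold scale
  linarith

theorem integral_value_hold_le_value (P : CIP n) {X : Fin n → ℤ} (hX : P.IsSolution X) :
    ∫ θ, P.value (P.hold P.rows.length θ) ∂thresholdLaw n ≤
      200 * Real.log ((max 2 P.rowSparsity : ℕ) : ℝ) *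
        Real.log ((max 2 P.colSparsity : ℕ) : ℝ) * P.value X := by
  have h1 := P.integral_value_hold_le hX P.scale_le
  have h2 := P.sum_cost_frac_le hX (le_max_left 2 P.rowSparsity) (le_max_right 2 P.rowSparsity)
  have hv := P.value_nonneg hX
  have hlog (a : ℕ) : 1 / 2 ≤ Real.log ((max 2 a : ℕ) : ℝ) := by
    have : Real.log 2 ≤ Real.log ((max 2 a : ℕ) : ℝ) :=
      Real.log_le_log (by norm_num) (by exact_mod_cast le_max_left _ _)
    linarith [Real.log_two_gt_d9]
  have hk := hlog P.rowSparsity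
  have hl := hlog P.colSparsity
  set K := Real.log ((max 2 P.rowSparsity : ℕ) : ℝ)
  set L := Real.log ((max 2 P.colSparsity : ℕ) : ℝ)
  -- This absorbs the completion cost: 16 · 12 + 2 · 4 = 200.
  have h3 : 1 ≤ 4 * (K * L) := by nlinarith
  calc _ ≤ 16 * L * ∑ i, P.cost i * P.frac P.rows.length i + 2 * P.value X := h1
    _ ≤ 16 * L * (12 * K * P.value X) + 2 * (4 * (K * L) * P.value X) := by
      gcongr
      exact le_mul_of_one_le_left hv h3
    _ = 200 * K * L * P.value X := by ring

end CIP

end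

theorem mainTheorem3 :
    ∃ C : ℝ, 0 < C ∧ ∃ alg : (n : ℕ) → RandomizedOnlineAlgorithm n, ∀ n : ℕ,
      (alg n).IsCompetitive fun P =>
        C * Real.log ((max 2 P.rowSparsity : ℕ) : ℝ) * Real.log ((max 2 P.colSparsity : ℕ) : ℝ) := by
  refine ⟨200, by norm_num, CIP.onlineAlgorithm, fun n P hP => ⟨fun θ t ht => ?_,
    fun θ s t hst ht i => ?_, ?_, ?_⟩⟩
  · rw [P.onlineAlgorithm_solution ht]
    exact P.hold_isSolution hP θ ht
  · rw [P.onlineAlgorithm_solution ht, P.onlineAlgorithm_solution (hst.trans ht)]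
    exact P.hold_mono θ hst i
  · simp_rw [P.onlineAlgorithm_solution le_rfl]
    exact P.integrable_value_hold hP
  · simp_rw [P.onlineAlgorithm_solution le_rfl]
    obtain ⟨X, hX⟩ := hP
    set ρ := 200 * Real.log ((max 2 P.rowSparsity : ℕ) : ℝ) *
      Real.log ((max 2 P.colSparsity : ℕ) : ℝ) with hρ
    have hρ0 : 0 < ρ := by
      have hlog (a : ℕ) : 0 < Real.log ((max 2 a : ℕ) : ℝ) :=
        Real.log_pos (by exact_mod_cast lt_of_lt_of_le one_lt_two (le_max_left 2 a))
      exact mul_pos (mul_pos (by norm_num) (hlog _)) (hlog _)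
    -- Since `opt` is an infimum, it suffices to bound the cost against every solution.
    rw [mul_comm, ← div_le_iff₀ hρ0]
    refine le_csInf ⟨_, X, hX, rfl⟩ ?_
    rintro _ ⟨Y, hY, rfl⟩
    rw [div_le_iff₀ hρ0, mul_comm]
    exact P.integral_value_hold_le_value hY
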